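/- Let $R>0$, let $H=\{p\in\mathbb{R}^4:\ |p|=R,\ p_4\ge 0\}$ be the hyper-hemisphere of radius $R$ in dimension $N=4$, and let $F_{NH}(d)$ be the cumulative distribution function of its chord length, i.e. the probability that two points chosen independently and uniformly (with respect to surface measure) on $H$ have Euclidean distance at most $d$. Write $$I_x(a,b)=\frac{\int_0^x t^{a-1}(1-t)^{b-1}\,dt}{B(a,b)},\qquad B(a,b)=\int_0^1 t^{a-1}(1-t)^{b-1}\,dt,\qquad s=\frac{d^2}{R^2}-\frac{d^4}{4R^4}.$$ Then, for $N=4$ and every $0\le d\le\sqrt2\,R$, $$F_{NH}(d)=P_1(d)-P_2(d)+P_3(d),$$ where $$P_1(d)=I_s\!\left(\tfrac{N-1}{2},\tfrac12\right)\left(1-\tfrac12\, I_s\!\left(\tfrac12,\tfrac{N-1}{2}\right)\right),$$ $$P_2(d)=\frac{2\,I_s\!\left(\tfrac{N-1}{2},\tfrac12\right)\left[\left(1-\tfrac{d^2}{2R^2}\right)^2-\left(1-\tfrac{d^2}{2R^2}\right)^N\right]}{(N-2)\,\pi\, B\!\left(\tfrac{N-1}{2},\tfrac12\right) I_s\!\left(\tfrac32,\tfrac12\right)},$$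 $$P_3(d)=\frac{2\,I_s\!\left(\tfrac{N-1}{2},\tfrac12\right)\displaystyle\int_0^{\arcsin\sqrt{s}}\theta\,(\cos\theta)^{N-2}\,d\theta}{\pi\, B\!\left(\tfrac{N-1}{2},\tfrac12\right) I_s\!\left(\tfrac32,\tfrac12\right)}.$$ At $d=0$, where the quotients $P_2$ and $P_3$ have the form $0/0$, they are given the value $0$, which is their limit as $d\to0^+$. -/

import Mathlib

open MeasureTheory

noncomputable section

/-- Surface measure of the sphere of radius `R` centred at the origin of `ℝ^N`, as a measure on
`ℝ^N`: the surface measure of the unit sphere, transported by `u ↦ R u` and scaled by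
`R ^ (N - 1)`. -/
def sphereSurface (N : ℕ) (R : ℝ) : Measure (EuclideanSpace ℝ (Fin N)) :=
  ENNReal.ofReal (R ^ (N - 1)) •
    ((volume : Measure (EuclideanSpace ℝ (Fin N))).toSphere).map
      (fun u : Metric.sphere (0 : EuclideanSpace ℝ (Fin N)) 1 =>
        R • (u : EuclideanSpace ℝ (Fin N)))

/-- The hyper-hemisphere of radius `R` in `ℝ^N`: the points of the sphere of radius `R` whose last
coordinate (the index `i` with `i + 1 = N`, indices being counted from `0`) is nonnegative. -/
def hyperHemisphere (N : ℕ) (R : ℝ) : Set (EuclideanSpace ℝ (Fin N)) :=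
  {p | p ∈ Metric.sphere (0 : EuclideanSpace ℝ (Fin N)) R ∧
    ∀ i : Fin N, (i : ℕ) + 1 = N → 0 ≤ p i}

/-- The uniform distribution on the hyper-hemisphere: surface measure conditioned on it, that is,
`A ↦ area (A ∩ H) / area H`. -/
def hemisphereUniform (N : ℕ) (R : ℝ) : Measure (EuclideanSpace ℝ (Fin N)) :=
  ProbabilityTheory.cond (sphereSurface N R) (hyperHemisphere N R)

/-- The hyper-hemisphere chord length cdf: the probability that two independent uniform points
of the hyper-hemisphere have Euclidean distance at most `d`. -/
def hemisphereChordCDF (N : ℕ) (R d : ℝ) : ℝ :=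
  ((hemisphereUniform N R).prod (hemisphereUniform N R)).real {x | dist x.1 x.2 ≤ d}

/-- The incomplete beta function `B(x; a, b) = ∫₀ˣ t^(a-1) (1-t)^(b-1) dt`. -/
def incBeta (x a b : ℝ) : ℝ :=
  ∫ t in (0 : ℝ)..x, t ^ (a - 1) * (1 - t) ^ (b - 1)

/-- The complete beta function `B(a, b) = B(1; a, b)`. -/
def completeBeta (a b : ℝ) : ℝ := incBeta 1 a b

/-- The regularised incomplete beta function `I_x(a, b) = B(x; a, b) / B(a, b)`. -/
def regBeta (x a b : ℝ) : ℝ := incBeta x a b / completeBeta a b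

/-- The argument `d² / R² - d⁴ / (4 R⁴)`. -/
def chordArg (R d : ℝ) : ℝ := d ^ 2 / R ^ 2 - d ^ 4 / (4 * R ^ 4)

def chordP1 (N : ℕ) (R d : ℝ) : ℝ :=
  regBeta (chordArg R d) (((N : ℝ) - 1) / 2) (1 / 2) *
    (1 - 1 / 2 * regBeta (chordArg R d) (1 / 2) (((N : ℝ) - 1) / 2))

def chordP2 (N : ℕ) (R d : ℝ) : ℝ :=
  (2 * regBeta (chordArg R d) (((N : ℝ) - 1) / 2) (1 / 2) *
      ((1 - d ^ 2 / (2 * R ^ 2)) ^ 2 - (1 - d ^ 2 / (2 * R ^ 2)) ^ N)) /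
    (((N : ℝ) - 2) * Real.pi * completeBeta (((N : ℝ) - 1) / 2) (1 / 2) *
      regBeta (chordArg R d) (3 / 2) (1 / 2))

def chordP3 (N : ℕ) (R d : ℝ) : ℝ :=
  (2 * regBeta (chordArg R d) (((N : ℝ) - 1) / 2) (1 / 2) *
      ∫ θ in (0 : ℝ)..Real.arcsin (Real.sqrt (chordArg R d)), θ * Real.cos θ ^ (N - 2)) /
    (Real.pi * completeBeta (((N : ℝ) - 1) / 2) (1 / 2) *
      regBeta (chordArg R d) (3 / 2) (1 / 2))

end

/-!
Write `d = 2R sin (α / 2)`, so that `cos α = 1 - d² / 2R²` and `s = sin² α`; two points of the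
sphere are at distance at most `d` exactly when their central angle is at most `α`.

A pair of points `x`, `y` of the whole sphere `S³` at angle `φ` lies in a random hemisphere with
probability `(π - φ) / 2π`, since the poles of the hemispheres containing both points form a lune of
angle `π - φ`. By rotation invariance the hemisphere `H` may be replaced by a random one. As the
angle between independent uniform points of `S³` has density proportional to `sin² φ`, and
`H` is half of the sphere, the chord length cdf is
`(4 / π²) ∫₀^α (π - φ) sin² φ dφ = (2 / π) (α - sin α cos α) - (α² - 2α sin α cos α + sin² α) / π²`.
The functions `I_s(3/2, 1/2)` and `I_s(1/2, 3/2)` equal `(2 / π) (α ∓ sin α cos α)`, and the claimed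
expression reduces to the same closed form (`chordP1_sub_chordP2_add_chordP3_four`).

The uniform distribution of the sphere is realised as the law of the direction of a Gaussian vector
(`sphereSurface_eq_smul_map_gaussianWeight`): the Gaussian density is both rotation invariant and a
product, so the lune (`gaussianWeight_lune`) and the law of the angle
(`exists_lintegral_gaussianWeight_angle`) are computed by Tonelli and planar polar coordinates. The
averaging over hemispheres is `exists_gaussianWeight_prod_pairsInCap`.
-/

open Set Metric Real InnerProductGeometry
open scoped ENNReal RealInnerProductSpace

/-! ### Polar coordinates and Tonelli -/

/-- Integration in polar coordinates for a Haar measure on a finite-dimensional normed space. -/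
theorem lintegral_eq_lintegral_toSphere {E : Type*} [NormedAddCommGroup E] [NormedSpace ℝ E]
    [FiniteDimensional ℝ E] [Nontrivial E] [MeasurableSpace E] [BorelSpace E] (μ : Measure E)
    [μ.IsAddHaarMeasure] {F : E → ℝ≥0∞} (hF : Measurable F) :
    ∫⁻ x, F x ∂μ = ∫⁻ u : sphere (0 : E) 1, (∫⁻ r in Ioi (0 : ℝ),
      ENNReal.ofReal (r ^ (Module.finrank ℝ E - 1)) * F (r • (u : E))) ∂μ.toSphere := by
  have hmeas : Measurable fun p : sphere (0 : E) 1 × Ioi (0 : ℝ) => F ((p.2 : ℝ) • (p.1 : E)) :=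
    hF.comp (by fun_prop)
  calc ∫⁻ x, F x ∂μ = ∫⁻ x : ({0}ᶜ : Set E), F x ∂(μ.comap (↑)) := by
        rw [lintegral_subtype_comap (measurableSet_singleton _).compl, restrict_compl_singleton]
    _ = ∫⁻ p : sphere (0 : E) 1 × Ioi (0 : ℝ), F ((p.2 : ℝ) • (p.1 : E))
          ∂(μ.toSphere.prod (.volumeIoiPow (Module.finrank ℝ E - 1))) := by
        rw [← μ.measurePreserving_homeomorphUnitSphereProd.lintegral_comp hmeas]
        refine lintegral_congr fun x => ?_
        have hx : ‖(x : E)‖ ≠ 0 := norm_ne_zero_iff.2 x.2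
        simp [smul_smul, hx]
    _ = ∫⁻ u : sphere (0 : E) 1, ∫⁻ r : Ioi (0 : ℝ), F ((r : ℝ) • (u : E))
          ∂(.volumeIoiPow (Module.finrank ℝ E - 1)) ∂μ.toSphere := by
        rw [lintegral_prod _ hmeas.aemeasurable]
    _ = _ := by
        refine lintegral_congr fun u => ?_
        rw [Measure.volumeIoiPow, lintegral_withDensity_eq_lintegral_mul _ (by fun_prop)
          (by exact hF.comp (by fun_prop))]
        simp only [Pi.mul_apply]
        rw [lintegral_subtype_comap measurableSet_Ioi fun r : ℝ =>
          ENNReal.ofReal (r ^ (Module.finrank ℝ E - 1)) * F (r • (u : E))]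

theorem lintegral_comp_norm {E : Type*} [NormedAddCommGroup E] [NormedSpace ℝ E]
    [FiniteDimensional ℝ E] [Nontrivial E] [MeasurableSpace E] [BorelSpace E] (μ : Measure E)
    [μ.IsAddHaarMeasure] {f : ℝ → ℝ≥0∞} (hf : Measurable f) :
    ∫⁻ x, f ‖x‖ ∂μ = μ.toSphere univ * ∫⁻ r in Ioi (0 : ℝ),
      ENNReal.ofReal (r ^ (Module.finrank ℝ E - 1)) * f r := by
  rw [lintegral_eq_lintegral_toSphere (F := fun x => f ‖x‖) μ (hf.comp measurable_norm)]
  have : ∀ u : sphere (0 : E) 1, ∫⁻ r in Ioi (0 : ℝ),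
      ENNReal.ofReal (r ^ (Module.finrank ℝ E - 1)) * f ‖r • (u : E)‖ = ∫⁻ r in Ioi (0 : ℝ),
      ENNReal.ofReal (r ^ (Module.finrank ℝ E - 1)) * f r := fun u =>
    setLIntegral_congr_fun measurableSet_Ioi fun r hr => by
      simp [norm_smul, abs_of_pos (mem_Ioi.1 hr)]
  simp only [this, lintegral_const]
  rw [mul_comm]

theorem EuclideanSpace.measurable_cons (n : ℕ) : Measurable fun p : ℝ × (Fin n → ℝ) =>
    (WithLp.toLp 2 (Fin.cons p.1 p.2 : Fin (n + 1) → ℝ)) := by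
  refine (PiLp.volume_preserving_toLp _).measurable.comp (measurable_pi_iff.2 fun i => ?_)
  refine Fin.cases ?_ (fun j => ?_) i
  · simpa using measurable_fst
  · simp only [Fin.cons_succ]; fun_prop

/-- Tonelli's theorem splitting off the first coordinate of `ℝⁿ⁺¹`, the remaining ones being kept
as a vector of the Euclidean space `ℝⁿ`. -/
theorem EuclideanSpace.lintegral_succ (n : ℕ) {F : EuclideanSpace ℝ (Fin (n + 1)) → ℝ≥0∞}
    (hF : Measurable F) :
    ∫⁻ x, F x = ∫⁻ t : ℝ, ∫⁻ w : EuclideanSpace ℝ (Fin n), F (WithLp.toLp 2 (Fin.cons t w)) := by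
  rw [← (PiLp.volume_preserving_toLp (Fin (n + 1))).lintegral_comp hF,
    ← (volume_preserving_piFinSuccAbove (fun _ : Fin (n + 1) => ℝ) 0).symm.lintegral_comp
      (by exact hF.comp (PiLp.volume_preserving_toLp _).measurable)]
  rw [Measure.volume_eq_prod, lintegral_prod]
  · refine lintegral_congr fun t => ?_
    rw [← (PiLp.volume_preserving_ofLp (Fin n)).lintegral_comp]
    · simp [MeasurableEquiv.piFinSuccAbove, Fin.insertNthEquiv]
    · exact hF.comp ((PiLp.volume_preserving_toLp _).measurable.comp
        ((MeasurableEquiv.measurable _).comp (by fun_prop)))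
  · exact (hF.comp ((PiLp.volume_preserving_toLp _).measurable.comp
        (MeasurableEquiv.measurable _))).aemeasurable

/-- The integral over the plane of a function that is a product in polar coordinates. -/
theorem lintegral_prod_eq_mul_of_polar {F : ℝ × ℝ → ℝ≥0∞} {f k : ℝ → ℝ≥0∞} (hf : Measurable f)
    (hk : Measurable k)
    (hF : ∀ r > 0, ∀ ψ ∈ Ioo (-π) π, F (r * cos ψ, r * sin ψ) = f r * k ψ) :
    ∫⁻ p, F p = (∫⁻ r in Ioi (0 : ℝ), ENNReal.ofReal r * f r) * ∫⁻ ψ in Ioo (-π) π, k ψ := by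
  rw [← lintegral_comp_polarCoord_symm, polarCoord_target]
  rw [setLIntegral_congr_fun (g := fun p : ℝ × ℝ => (ENNReal.ofReal p.1 * f p.1) * k p.2)
    (measurableSet_Ioi.prod measurableSet_Ioo)]
  · rw [Measure.volume_eq_prod, ← Measure.prod_restrict]
    exact lintegral_prod_mul (f := fun r => ENNReal.ofReal r * f r) (by fun_prop) (by fun_prop)
  · rintro ⟨r, ψ⟩ ⟨hr, hψ⟩
    simp only [polarCoord_symm_apply, smul_eq_mul]
    rw [hF r hr ψ hψ, mul_assoc]

/-! ### The Gaussian weight -/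

/-- The measure with density `exp (-‖x‖²)`. It is not normalised: only ratios of its values
matter. -/
noncomputable def gaussianWeight (E : Type*) [NormedAddCommGroup E] [MeasureSpace E] : Measure E :=
  volume.withDensity fun x => ENNReal.ofReal (exp (-‖x‖ ^ 2))

section gaussianWeight

variable {E : Type*} [NormedAddCommGroup E] [InnerProductSpace ℝ E] [FiniteDimensional ℝ E]
  [MeasurableSpace E] [BorelSpace E]

theorem lintegral_gaussianWeight {F : E → ℝ≥0∞} (hF : Measurable F) :
    ∫⁻ x, F x ∂gaussianWeight E = ∫⁻ x, ENNReal.ofReal (exp (-‖x‖ ^ 2)) * F x := by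
  rw [gaussianWeight, lintegral_withDensity_eq_lintegral_mul _ (by fun_prop) hF]
  rfl

instance : IsFiniteMeasure (gaussianWeight E) := by
  have h := GaussianFourier.integral_rexp_neg_mul_sq_norm (V := E) (b := 1) one_pos
  refine isFiniteMeasure_withDensity_ofReal (Integrable.hasFiniteIntegral ?_)
  by_contra hi
  rw [integral_undef (by simpa using hi)] at h
  exact (Real.rpow_pos_of_pos (by positivity) _).ne h

theorem gaussianWeight_univ_ne_zero : gaussianWeight E univ ≠ 0 := by
  rw [gaussianWeight, Ne, Measure.measure_univ_eq_zero,
    withDensity_eq_zero_iff (by fun_prop)]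
  intro h
  have : (volume : Measure E) = 0 := by
    rw [← ae_eq_bot]
    by_contra h'
    have : (ae (volume : Measure E)).NeBot := ⟨h'⟩
    obtain ⟨x, hx⟩ := h.exists
    simp at hx
    exact absurd hx (not_le.2 (exp_pos _))
  exact NeZero.ne _ this

theorem gaussianWeight_absolutelyContinuous : gaussianWeight E ≪ volume :=
  withDensity_absolutelyContinuous _ _

theorem ae_ne_zero_gaussianWeight [Nontrivial E] : ∀ᵐ x ∂gaussianWeight E, x ≠ 0 :=
  gaussianWeight_absolutelyContinuous.ae_le (Measure.ae_ne volume 0)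

theorem LinearIsometryEquiv.measurePreserving_gaussianWeight {F : Type*} [NormedAddCommGroup F]
    [InnerProductSpace ℝ F] [FiniteDimensional ℝ F] [MeasurableSpace F] [BorelSpace F]
    (e : E ≃ₗᵢ[ℝ] F) :
    MeasurePreserving e (gaussianWeight E) (gaussianWeight F) := by
  refine ⟨e.continuous.measurable, Measure.ext fun s hs => ?_⟩
  rw [Measure.map_apply e.continuous.measurable hs, gaussianWeight, gaussianWeight,
    withDensity_apply _ hs, withDensity_apply _ (e.continuous.measurable hs),
    ← e.measurePreserving.setLIntegral_comp_preimage hs (by fun_prop)]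
  simp

/-- The direction of a Gaussian vector is uniform on the unit sphere, up to normalisation. -/
theorem map_normalize_gaussianWeight [Nontrivial E] :
    ∃ c : ℝ≥0∞, c ≠ 0 ∧ c ≠ ∞ ∧ (gaussianWeight E).map (fun x => ‖x‖⁻¹ • x) =
      c • ((volume : Measure E).toSphere).map (fun u : sphere (0 : E) 1 => (u : E)) := by
  set c := ∫⁻ r in Ioi (0 : ℝ), ENNReal.ofReal (r ^ (Module.finrank ℝ E - 1)) *
    ENNReal.ofReal (exp (-r ^ 2)) with hc
  have hm : Measurable fun x : E => ‖x‖⁻¹ • x := by fun_prop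
  have key : (gaussianWeight E).map (fun x => ‖x‖⁻¹ • x) =
      c • ((volume : Measure E).toSphere).map (fun u : sphere (0 : E) 1 => (u : E)) := by
    refine Measure.ext_of_lintegral _ fun F hF => ?_
    rw [lintegral_map hF hm, lintegral_smul_measure, lintegral_map hF measurable_subtype_coe,
      lintegral_gaussianWeight (F := fun x => F (‖x‖⁻¹ • x)) (hF.comp hm),
      lintegral_eq_lintegral_toSphere]
    · rw [smul_eq_mul, ← lintegral_const_mul _ (by fun_prop)]
      refine lintegral_congr fun u => ?_
      rw [hc, ← lintegral_mul_const _ (by fun_prop)]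
      refine setLIntegral_congr_fun measurableSet_Ioi fun r hr => ?_
      have hr : 0 < r := hr
      simp [norm_smul, abs_of_pos hr, smul_smul, hr.ne', mul_assoc]
    · fun_prop
  -- Both total masses are finite and nonzero, which forces the same of `c`.
  have hu := congrArg (fun m => m univ) key
  simp only [Measure.map_apply hm .univ, preimage_univ, Measure.smul_apply,
    Measure.map_apply measurable_subtype_coe .univ, smul_eq_mul] at hu
  refine ⟨c, ?_, ?_, key⟩
  · rintro h
    rw [h, zero_mul] at hu
    exact gaussianWeight_univ_ne_zero hu
  · rintro h
    rw [h, ENNReal.top_mul (by simp [-Measure.toSphere_apply_univ])] at hu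
    exact measure_ne_top _ _ hu

end gaussianWeight

/-! ### Wedges and angles in coordinates -/

theorem EuclideanSpace.norm_sq_cons {n : ℕ} (t : ℝ) (w : Fin n → ℝ) :
    ‖(WithLp.toLp 2 (Fin.cons t w : Fin (n + 1) → ℝ) : EuclideanSpace ℝ (Fin (n + 1)))‖ ^ 2 =
      t ^ 2 + ‖(WithLp.toLp 2 w : EuclideanSpace ℝ (Fin n))‖ ^ 2 := by
  simp [EuclideanSpace.norm_sq_eq, Fin.sum_univ_succ]

/-- A function of the first two coordinates sees the two-dimensional Gaussian weight. -/
theorem lintegral_gaussianWeight_comp_plane (n : ℕ) {F : ℝ × ℝ → ℝ≥0∞} (hF : Measurable F) :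
    ∫⁻ v, F (v 0, v 1) ∂gaussianWeight (EuclideanSpace ℝ (Fin (n + 2))) =
      gaussianWeight (EuclideanSpace ℝ (Fin n)) univ *
        ∫⁻ p : ℝ × ℝ, ENNReal.ofReal (exp (-(p.1 ^ 2 + p.2 ^ 2))) * F p := by
  have hm : Measurable fun v : EuclideanSpace ℝ (Fin (n + 2)) => F (v 0, v 1) := by fun_prop
  rw [lintegral_gaussianWeight hm, EuclideanSpace.lintegral_succ (n + 1) (by fun_prop),
    Measure.volume_eq_prod, lintegral_prod _ (by fun_prop), ← lintegral_const_mul _ (by fun_prop)]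
  refine lintegral_congr fun s => ?_
  rw [EuclideanSpace.lintegral_succ n, ← lintegral_const_mul _ (by fun_prop)]
  · refine lintegral_congr fun t => ?_
    rw [gaussianWeight, withDensity_apply _ .univ, Measure.restrict_univ,
      ← lintegral_mul_const _ (by fun_prop)]
    refine lintegral_congr fun w => ?_
    rw [EuclideanSpace.norm_sq_cons, EuclideanSpace.norm_sq_cons, ← mul_assoc,
      ← ENNReal.ofReal_mul (exp_pos _).le, ← exp_add]
    congr 3
    simp; ring
  · have hc : Measurable fun w : EuclideanSpace ℝ (Fin (n + 1)) =>
        (WithLp.toLp 2 (Fin.cons s w : Fin (n + 2) → ℝ) : EuclideanSpace ℝ (Fin (n + 2))) :=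
      (EuclideanSpace.measurable_cons (n + 1)).comp (f := fun w : EuclideanSpace ℝ (Fin (n + 1)) =>
        (s, (w : Fin (n + 1) → ℝ))) (by fun_prop)
    exact Measurable.comp (g := fun v : EuclideanSpace ℝ (Fin (n + 2)) =>
      ENNReal.ofReal (exp (-‖v‖ ^ 2)) * F (v 0, v 1)) (by fun_prop) hc

/-- The wedge `{v | 0 ≤ v 0 ∧ 0 ≤ cos θ * v 0 + sin θ * v 1}` has opening angle `π - θ`, hence
carries the proportion `(π - θ) / 2π` of the Gaussian weight. -/
theorem gaussianWeight_wedge (n : ℕ) {θ : ℝ} (h₀ : 0 ≤ θ) (h₁ : θ < π) :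
    gaussianWeight (EuclideanSpace ℝ (Fin (n + 2)))
        {v | 0 ≤ v 0 ∧ 0 ≤ cos θ * v 0 + sin θ * v 1} =
      gaussianWeight (EuclideanSpace ℝ (Fin (n + 2))) univ *
        ENNReal.ofReal ((π - θ) / (2 * π)) := by
  have key : ∀ S : Set (ℝ × ℝ), ∀ T : Set ℝ, MeasurableSet S → MeasurableSet T →
      (∀ r > 0, ∀ ψ ∈ Ioo (-π) π, ((r * cos ψ, r * sin ψ) ∈ S ↔ ψ ∈ T)) →
      gaussianWeight (EuclideanSpace ℝ (Fin (n + 2))) {v | (v 0, v 1) ∈ S} =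
        gaussianWeight (EuclideanSpace ℝ (Fin n)) univ *
          (∫⁻ r in Ioi (0 : ℝ), ENNReal.ofReal r * ENNReal.ofReal (exp (-r ^ 2))) *
          volume (T ∩ Ioo (-π) π) := by
    intro S T hS hT h
    have hm : Measurable (S.indicator (1 : ℝ × ℝ → ℝ≥0∞)) := measurable_one.indicator hS
    have hS' : MeasurableSet {v : EuclideanSpace ℝ (Fin (n + 2)) | (v 0, v 1) ∈ S} :=
      (by fun_prop : Measurable fun v : EuclideanSpace ℝ (Fin (n + 2)) => (v 0, v 1)) hS
    rw [← lintegral_indicator_one hS', mul_assoc, ← Measure.restrict_apply hT,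
      ← lintegral_indicator_one hT,
      ← lintegral_prod_eq_mul_of_polar (F := fun p => ENNReal.ofReal (exp (-(p.1 ^ 2 + p.2 ^ 2))) *
        S.indicator 1 p) (by fun_prop) (measurable_one.indicator hT),
      ← lintegral_gaussianWeight_comp_plane n hm]
    · rfl
    · intro r hr ψ hψ
      have h1 : (r * cos ψ) ^ 2 + (r * sin ψ) ^ 2 = r ^ 2 := by
        linear_combination r ^ 2 * cos_sq_add_sin_sq ψ
      simp only [h1, indicator, Pi.one_apply]
      congr 2
      exact propext (h r hr ψ hψ)
  -- The radial factor is the same for the wedge and for the whole space, so only the angular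
  -- lengths `π - θ` and `2π` matter.
  have huniv := key univ univ .univ .univ (by simp)
  rw [univ_inter, Real.volume_Ioo] at huniv
  rw [show {v : EuclideanSpace ℝ (Fin (n + 2)) | (v 0, v 1) ∈ (univ : Set (ℝ × ℝ))} = univ by simp]
    at huniv
  have hwedge := key {p | 0 ≤ p.1 ∧ 0 ≤ cos θ * p.1 + sin θ * p.2} (Icc (θ - π / 2) (π / 2))
    (by measurability) measurableSet_Icc ?_
  · have hsub : Icc (θ - π / 2) (π / 2) ⊆ Ioo (-π) π := fun ψ hψ =>
      show ψ ∈ Ioo (-π) π from ⟨by linarith [hψ.1, pi_pos], by linarith [hψ.2, pi_pos]⟩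
    rw [inter_eq_left.2 hsub, Real.volume_Icc] at hwedge
    refine hwedge.trans ?_
    rw [huniv, mul_assoc _ (ENNReal.ofReal _), ← ENNReal.ofReal_mul (by linarith [pi_pos])]
    congr 2
    field_simp
    ring
  · intro r hr ψ hψ
    have e : cos θ * (r * cos ψ) + sin θ * (r * sin ψ) = r * cos (ψ - θ) := by
      rw [cos_sub]; ring
    simp only [mem_ofPred_eq, mem_Icc, e, mul_nonneg_iff_of_pos_left hr]
    constructor
    · rintro ⟨hc, hc'⟩
      have h2 : ψ ≤ π / 2 := by
        by_contra! h
        exact absurd (cos_neg_of_pi_div_two_lt_of_lt h (by linarith [hψ.2, pi_pos])) (not_lt.2 hc)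
      have h3 : -(π / 2) ≤ ψ := by
        by_contra! h
        refine absurd (cos_neg_of_pi_div_two_lt_of_lt (x := -ψ) (by linarith)
          (by linarith [hψ.1, pi_pos])) (not_lt.2 ?_)
        rwa [cos_neg]
      refine ⟨?_, h2⟩
      -- Here `θ < π` is used: `π / 2 < θ - ψ < 3π / 2`.
      by_contra! h
      refine absurd (cos_neg_of_pi_div_two_lt_of_lt (x := -(ψ - θ)) (by linarith)
        (by linarith)) (not_lt.2 ?_)
      rwa [cos_neg]
    · rintro ⟨ha, hb⟩
      exact ⟨cos_nonneg_of_neg_pi_div_two_le_of_le (by linarith) hb,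
        cos_nonneg_of_neg_pi_div_two_le_of_le (by linarith) (by linarith)⟩

/-- The law of the angle between a Gaussian vector of `ℝⁿ⁺²` and the first coordinate axis has
density proportional to `sin φ ^ n`: split `v = (t, w)`, integrate over the direction of `w`, and
pass to polar coordinates in the half-plane of the points `(t, ‖w‖)`. -/
theorem exists_lintegral_gaussianWeight_arccos (n : ℕ) :
    ∃ C : ℝ≥0∞, ∀ G : ℝ → ℝ≥0∞, Measurable G →
      ∫⁻ v, G (arccos (v 0 / ‖v‖)) ∂gaussianWeight (EuclideanSpace ℝ (Fin (n + 2))) =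
        C * ∫⁻ φ in Ioo 0 π, ENNReal.ofReal (sin φ ^ n) * G φ := by
  refine ⟨(volume : Measure (EuclideanSpace ℝ (Fin (n + 1)))).toSphere univ *
    ∫⁻ r in Ioi (0 : ℝ), ENNReal.ofReal r *
      (ENNReal.ofReal (r ^ n) * ENNReal.ofReal (exp (-r ^ 2))), fun G hG => ?_⟩
  have hm : Measurable fun v : EuclideanSpace ℝ (Fin (n + 2)) => G (arccos (v 0 / ‖v‖)) := by
    fun_prop
  set F : ℝ × ℝ → ℝ≥0∞ := fun p => ENNReal.ofReal (exp (-(p.1 ^ 2 + p.2 ^ 2))) *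
    G (arccos (p.1 / √(p.1 ^ 2 + p.2 ^ 2))) with hF
  have hFm : Measurable F := by fun_prop
  have hnorm : ∀ (t : ℝ) (w : EuclideanSpace ℝ (Fin (n + 1))),
      ‖(WithLp.toLp 2 (Fin.cons t w : Fin (n + 2) → ℝ) : EuclideanSpace ℝ (Fin (n + 2)))‖ =
        √(t ^ 2 + ‖w‖ ^ 2) := fun t w => by
    rw [← sqrt_sq (norm_nonneg (WithLp.toLp 2 (Fin.cons t w : Fin (n + 2) → ℝ))),
      EuclideanSpace.norm_sq_cons]
  rw [lintegral_gaussianWeight hm, EuclideanSpace.lintegral_succ (n + 1) (by fun_prop), mul_assoc]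
  calc _ = ∫⁻ t : ℝ, ∫⁻ w : EuclideanSpace ℝ (Fin (n + 1)), F (t, ‖w‖) := by
        refine lintegral_congr fun t => lintegral_congr fun w => ?_
        rw [hnorm, sq_sqrt (by positivity)]
        simp [hF]
    _ = ∫⁻ t : ℝ, (volume : Measure (EuclideanSpace ℝ (Fin (n + 1)))).toSphere univ *
          ∫⁻ r in Ioi (0 : ℝ), ENNReal.ofReal (r ^ n) * F (t, r) := by
        refine lintegral_congr fun t => ?_
        rw [lintegral_comp_norm (f := fun r => F (t, r)) _ (by fun_prop),
          finrank_euclideanSpace_fin, Nat.add_sub_cancel]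
    _ = (volume : Measure (EuclideanSpace ℝ (Fin (n + 1)))).toSphere univ *
          ∫⁻ p : ℝ × ℝ,
            (Ioi (0 : ℝ)).indicator (fun r => ENNReal.ofReal (r ^ n) * F (p.1, r)) p.2 := by
        have hi : Measurable fun p : ℝ × ℝ =>
            (Ioi (0 : ℝ)).indicator (fun r => ENNReal.ofReal (r ^ n) * F (p.1, r)) p.2 := by
          exact Measurable.indicator (s := Prod.snd ⁻¹' Ioi (0 : ℝ)) (f := fun p : ℝ × ℝ =>
            ENNReal.ofReal (p.2 ^ n) * F (p.1, p.2)) (by fun_prop)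
            (measurable_snd measurableSet_Ioi)
        simp only [← lintegral_indicator measurableSet_Ioi]
        rw [Measure.volume_eq_prod, lintegral_prod _ hi.aemeasurable,
          lintegral_const_mul _ (by exact hi.lintegral_prod_right)]
    _ = _ := by
        congr 1
        rw [lintegral_prod_eq_mul_of_polar (f := fun r => ENNReal.ofReal (r ^ n) *
            ENNReal.ofReal (exp (-r ^ 2)))
          (k := (Ioo 0 π).indicator fun φ => ENNReal.ofReal (sin φ ^ n) * G φ) (by fun_prop)
          (Measurable.indicator (by fun_prop) measurableSet_Ioo)]
        · rw [lintegral_indicator measurableSet_Ioo, Measure.restrict_restrict measurableSet_Ioo,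
            inter_eq_left.2 (Ioo_subset_Ioo (by linarith [pi_pos]) le_rfl)]
        · intro r hr ψ hψ
          have hr : 0 < r := hr
          have h1 : (r * cos ψ) ^ 2 + (r * sin ψ) ^ 2 = r ^ 2 := by
            linear_combination r ^ 2 * cos_sq_add_sin_sq ψ
          by_cases h : 0 < ψ
          · have hs : 0 < sin ψ := sin_pos_of_pos_of_lt_pi h hψ.2
            rw [indicator_of_mem (show r * sin ψ ∈ Ioi (0 : ℝ) from mul_pos hr hs),
              indicator_of_mem (show ψ ∈ Ioo 0 π from ⟨h, hψ.2⟩)]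
            simp only [hF, h1, sqrt_sq hr.le, mul_div_cancel_left₀ _ hr.ne',
              arccos_cos h.le hψ.2.le]
            rw [mul_pow, ENNReal.ofReal_mul (pow_nonneg hr.le n)]
            ring
          · have hs : sin ψ ≤ 0 := sin_nonpos_of_nonpos_of_neg_pi_le (not_lt.1 h) hψ.1.le
            rw [indicator_of_notMem (show r * sin ψ ∉ Ioi (0 : ℝ) from
                not_lt.2 (mul_nonpos_of_nonneg_of_nonpos hr.le hs)),
              indicator_of_notMem (fun h' => h h'.1), mul_zero]

/-- An orthonormal basis in which `x` lies on the first axis and `y` in the upper half of the first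
coordinate plane. -/
theorem exists_orthonormalBasis_adapted {E : Type*} [NormedAddCommGroup E] [InnerProductSpace ℝ E]
    [FiniteDimensional ℝ E] {n : ℕ} (hn : Module.finrank ℝ E = n + 2) {x : E} (hx : x ≠ 0) (y : E) :
    ∃ b : OrthonormalBasis (Fin (n + 2)) ℝ E, ∃ p q : ℝ, 0 ≤ q ∧ x = ‖x‖ • b 0 ∧
      y = p • b 0 + q • b 1 := by
  have hx' : ‖x‖ ≠ 0 := norm_ne_zero_iff.2 hx
  set u := ‖x‖⁻¹ • x with hu
  have hu1 : ‖u‖ = 1 := by simp [hu, norm_smul, hx']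
  have hxu : x = ‖x‖ • u := by simp [hu, smul_smul, hx']
  -- Gram–Schmidt by hand; `b 1` is unconstrained when `y` is parallel to `x`.
  set z := y - ⟪u, y⟫ • u with hz
  have huz : ⟪u, z⟫ = (0 : ℝ) := by simp [hz, inner_sub_right, inner_smul_right, hu1]
  have hzu : ⟪z, u⟫ = (0 : ℝ) := by rw [real_inner_comm, huz]
  have hyz : y = ⟪u, y⟫ • u + z := by simp [hz]
  -- Keeps `simp` from unfolding `u` and `z`.
  clear_value z u
  by_cases hz0 : z = 0
  · obtain ⟨b, hb⟩ := Orthonormal.exists_orthonormalBasis_extension_of_card_eq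
      (𝕜 := ℝ) (ι := Fin (n + 2)) (by simpa using hn) (v := fun _ => u) (s := {0})
      ⟨by simp [hu1], fun i j hij => absurd (Subsingleton.elim i j) hij⟩
    have hb0 : b 0 = u := hb 0 rfl
    refine ⟨b, ⟪u, y⟫, 0, le_rfl, by rwa [hb0], ?_⟩
    rw [hb0, zero_smul, add_zero]
    rwa [hz0, add_zero] at hyz
  · have hz' : ‖z‖ ≠ 0 := norm_ne_zero_iff.2 hz0
    obtain ⟨b, hb⟩ := Orthonormal.exists_orthonormalBasis_extension_of_card_eq
      (𝕜 := ℝ) (ι := Fin (n + 2)) (by simpa using hn)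
      (v := fun i => if i = 0 then u else ‖z‖⁻¹ • z) (s := {0, 1}) (by
        rw [orthonormal_iff_ite]
        rintro ⟨i, rfl | rfl⟩ ⟨j, rfl | rfl⟩
        · simp [hu1]
        · rw [if_neg fun h => zero_ne_one (congrArg Subtype.val h)]
          simpa [hz', inner_smul_right] using huz
        · rw [if_neg fun h => zero_ne_one (congrArg Subtype.val h).symm]
          simpa [hz', inner_smul_left] using hzu
        · simp [norm_smul, hz'])
    have hb0 : b 0 = u := by simpa using hb 0 (by simp)
    have hb1 : b 1 = ‖z‖⁻¹ • z := by simpa using hb 1 (by simp)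
    exact ⟨b, ⟪u, y⟫, ‖z‖, norm_nonneg _, by rwa [hb0], by
      rw [hb0, hb1, smul_inv_smul₀ hz']; exact hyz⟩

/-! ### Pairs of vectors in a half-space -/

section angles

variable {E : Type*} [NormedAddCommGroup E] [InnerProductSpace ℝ E] [FiniteDimensional ℝ E]
  [MeasurableSpace E] [BorelSpace E]

theorem measurable_angle_right (x : E) : Measurable fun y => angle x y := by
  unfold angle
  fun_prop

/-- Two half-spaces whose normals form the angle `θ` meet in the proportion `(π - θ) / 2π` of the
Gaussian weight. -/
theorem gaussianWeight_lune {n : ℕ} (hn : Module.finrank ℝ E = n + 2) {x y : E} (hx : x ≠ 0)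
    (hy : y ≠ 0) (hxy : angle x y < π) :
    gaussianWeight E {e | 0 ≤ ⟪e, x⟫ ∧ 0 ≤ ⟪e, y⟫} =
      gaussianWeight E univ * ENNReal.ofReal ((π - angle x y) / (2 * π)) := by
  obtain ⟨b, p, q, hq, hxb, hyb⟩ := exists_orthonormalBasis_adapted hn hx y
  have hx' : 0 < ‖x‖ := norm_pos_iff.2 hx
  have hy' : 0 < ‖y‖ := norm_pos_iff.2 hy
  have h00 : ⟪b 0, b 0⟫ = (1 : ℝ) := by simp
  have h11 : ⟪b 1, b 1⟫ = (1 : ℝ) := by simp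
  have h01 : ⟪b 0, b 1⟫ = (0 : ℝ) := b.orthonormal.2 (by simp)
  have h10 : ⟪b 1, b 0⟫ = (0 : ℝ) := b.orthonormal.2 (by simp)
  have hp : p = ‖y‖ * cos (angle x y) := by
    have h := cos_angle_mul_norm_mul_norm x y
    have h2 : ⟪x, y⟫ = ‖x‖ * p := by
      conv_lhs => rw [hxb, hyb]
      simp only [inner_add_right, inner_smul_left, inner_smul_right, h00, h01]
      simp [mul_comm]
    rw [h2] at h
    exact mul_left_cancel₀ hx'.ne' (by linear_combination -h)
  have hpq : ‖y‖ ^ 2 = p ^ 2 + q ^ 2 := by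
    rw [← real_inner_self_eq_norm_sq]
    conv_lhs => rw [hyb]
    simp only [inner_add_right, inner_add_left, inner_smul_left, inner_smul_right, h00, h01,
      h10, h11]
    simp; ring
  have hq' : q = ‖y‖ * sin (angle x y) := by
    refine (pow_left_inj₀ hq (mul_nonneg hy'.le (sin_angle_nonneg x y)) two_ne_zero).1 ?_
    rw [hp] at hpq
    linear_combination -hpq - ‖y‖ ^ 2 * sin_sq_add_cos_sq (angle x y)
  have hmp := b.repr.measurePreserving_gaussianWeight
  have hwedge := gaussianWeight_wedge n (angle_nonneg x y) hxy
  rw [← hmp.measure_preimage_equiv (f := b.repr.toHomeomorph.toMeasurableEquiv),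
    ← hmp.measure_preimage_equiv (f := b.repr.toHomeomorph.toMeasurableEquiv)] at hwedge
  refine Eq.trans (congrArg _ (Set.ext fun e => ?_)) hwedge
  have e0 : ⟪e, b 0⟫ = b.repr e 0 := by rw [b.repr_apply_apply, real_inner_comm]
  have e1 : ⟪e, b 1⟫ = b.repr e 1 := by rw [b.repr_apply_apply, real_inner_comm]
  have hex : ⟪e, x⟫ = ‖x‖ * b.repr e 0 := by
    conv_lhs => rw [hxb]
    rw [inner_smul_right, e0]
  have hey : ⟪e, y⟫ = ‖y‖ * (cos (angle x y) * b.repr e 0 + sin (angle x y) * b.repr e 1) := by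
    conv_lhs => rw [hyb]
    rw [inner_add_right, inner_smul_right, inner_smul_right, e0, e1, hp, hq']
    ring
  change (0 ≤ ⟪e, x⟫ ∧ 0 ≤ ⟪e, y⟫) ↔ (0 ≤ b.repr e 0 ∧
    0 ≤ cos (angle x y) * b.repr e 0 + sin (angle x y) * b.repr e 1)
  rw [hex, hey, mul_nonneg_iff_of_pos_left hx', mul_nonneg_iff_of_pos_left hy']

theorem gaussianWeight_halfSpace {n : ℕ} (hn : Module.finrank ℝ E = n + 2) {x : E} (hx : x ≠ 0) :
    gaussianWeight E {e | 0 ≤ ⟪e, x⟫} = gaussianWeight E univ * ENNReal.ofReal (1 / 2) := by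
  have h := gaussianWeight_lune hn hx hx (by rw [angle_self hx]; exact pi_pos)
  rw [angle_self hx] at h
  convert h using 3
  · simp
  · field_simp; ring

/-- The constant `C` depends neither on `G` nor on `x`; taking `G = 1` determines it. -/
theorem exists_lintegral_gaussianWeight_angle {n : ℕ} (hn : Module.finrank ℝ E = n + 2) :
    ∃ C : ℝ≥0∞, ∀ G : ℝ → ℝ≥0∞, Measurable G → ∀ x : E, x ≠ 0 →
      ∫⁻ y, G (angle x y) ∂gaussianWeight E =
        C * ∫⁻ φ in Ioo 0 π, ENNReal.ofReal (sin φ ^ n) * G φ := by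
  obtain ⟨C, hC⟩ := exists_lintegral_gaussianWeight_arccos n
  refine ⟨C, fun G hG x hx => ?_⟩
  obtain ⟨b, -, -, -, hxb, -⟩ := exists_orthonormalBasis_adapted hn hx 0
  have hx' : 0 < ‖x‖ := norm_pos_iff.2 hx
  rw [← hC G hG, ← b.repr.measurePreserving_gaussianWeight.lintegral_comp (by fun_prop)]
  refine lintegral_congr fun y => ?_
  have h : ⟪x, y⟫ = ‖x‖ * b.repr y 0 := by
    conv_lhs => rw [hxb]
    rw [real_inner_smul_left, b.repr_apply_apply]
  rw [angle, h, mul_div_mul_left _ _ hx'.ne', LinearIsometryEquiv.norm_map]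

/-- The pairs of vectors in the half-space of normal `e` whose angle is at most `α`. -/
def pairsInCap (e : E) (α : ℝ) : Set (E × E) :=
  {p | 0 ≤ ⟪e, p.1⟫ ∧ 0 ≤ ⟪e, p.2⟫ ∧ angle p.1 p.2 ≤ α}

/-- By rotation invariance, the weight of `pairsInCap e α` does not depend on `e`. -/
theorem gaussianWeight_prod_pairsInCap_congr {n : ℕ} (hn : Module.finrank ℝ E = n + 2) (α : ℝ)
    {e e' : E} (he : e ≠ 0) (he' : e' ≠ 0) :
    ((gaussianWeight E).prod (gaussianWeight E)) (pairsInCap e α) =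
      ((gaussianWeight E).prod (gaussianWeight E)) (pairsInCap e' α) := by
  obtain ⟨b, -, -, -, heb, -⟩ := exists_orthonormalBasis_adapted hn he 0
  obtain ⟨b', -, -, -, heb', -⟩ := exists_orthonormalBasis_adapted hn he' 0
  set U : E ≃ₗᵢ[ℝ] E := b.repr.trans b'.repr.symm with hU
  have hUb : U (b 0) = b' 0 := by simp [hU]
  have hmp := U.measurePreserving_gaussianWeight
  have hmpp := hmp.prod hmp
  rw [← hmpp.measure_preimage_equiv (f := U.toHomeomorph.toMeasurableEquiv.prodCongr
    U.toHomeomorph.toMeasurableEquiv) (pairsInCap e' α)]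
  refine congrArg _ (Set.ext fun p => ?_)
  have h : ∀ x : E, 0 ≤ ⟪e, x⟫ ↔ 0 ≤ ⟪e', U x⟫ := fun x => by
    rw [heb, heb', real_inner_smul_left, real_inner_smul_left,
      mul_nonneg_iff_of_pos_left (norm_pos_iff.2 he),
      mul_nonneg_iff_of_pos_left (norm_pos_iff.2 he'), ← hUb, U.inner_map_map]
  change (0 ≤ ⟪e, p.1⟫ ∧ 0 ≤ ⟪e, p.2⟫ ∧ angle p.1 p.2 ≤ α) ↔
    (0 ≤ ⟪e', U p.1⟫ ∧ 0 ≤ ⟪e', U p.2⟫ ∧ angle (U p.1) (U p.2) ≤ α)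
  rw [h, h, ← U.toLinearIsometry.angle_map p.1 p.2]
  rfl

theorem measurableSet_setOf_mem_pairsInCap (α : ℝ) :
    MeasurableSet {q : E × (E × E) | q.2 ∈ pairsInCap q.1 α} := by
  have h1 : MeasurableSet {q : E × (E × E) | 0 ≤ ⟪q.1, q.2.1⟫} :=
    measurableSet_le (by fun_prop) (by fun_prop)
  have h2 : MeasurableSet {q : E × (E × E) | 0 ≤ ⟪q.1, q.2.2⟫} :=
    measurableSet_le (by fun_prop) (by fun_prop)
  have h3 : MeasurableSet {q : E × (E × E) | angle q.2.1 q.2.2 ≤ α} :=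
    measurableSet_le (by unfold angle; fun_prop) measurable_const
  exact h1.inter (h2.inter h3)

/-- For fixed `x` and `y`, the normals `e` with `(x, y) ∈ pairsInCap e α` form a lune. -/
theorem gaussianWeight_setOf_mem_pairsInCap {n : ℕ} (hn : Module.finrank ℝ E = n + 2) {α : ℝ}
    (hα : α < π) {x y : E} (hx : x ≠ 0) (hy : y ≠ 0) :
    gaussianWeight E {e | (x, y) ∈ pairsInCap e α} = gaussianWeight E univ *
      (Iic α).indicator (fun φ => ENNReal.ofReal ((π - φ) / (2 * π))) (angle x y) := by
  by_cases h : angle x y ≤ α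
  · rw [indicator_of_mem (mem_Iic.2 h), ← gaussianWeight_lune hn hx hy (h.trans_lt hα)]
    refine congrArg _ (Set.ext fun e => ?_)
    simp [pairsInCap, h]
  · rw [indicator_of_notMem (by simpa using h), mul_zero]
    simp [pairsInCap, h]

/-- As the weight of `pairsInCap e α` does not depend on `e`, it may be averaged over `e`.
Exchanging the order of integration turns the average into an integral of the lune area over the
angle between the two vectors. -/
theorem exists_gaussianWeight_prod_pairsInCap {n : ℕ} (hn : Module.finrank ℝ E = n + 2) :
    ∃ C : ℝ≥0∞, gaussianWeight E univ = C * ∫⁻ φ in Ioo 0 π, ENNReal.ofReal (sin φ ^ n) ∧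
      ∀ (e : E) (α : ℝ), e ≠ 0 → α < π →
        ((gaussianWeight E).prod (gaussianWeight E)) (pairsInCap e α) =
          gaussianWeight E univ * (C * ∫⁻ φ in Ioo 0 π, ENNReal.ofReal (sin φ ^ n) *
            (Iic α).indicator (fun φ => ENNReal.ofReal ((π - φ) / (2 * π))) φ) := by
  have : Nontrivial E := Module.nontrivial_of_finrank_pos (R := ℝ) (by omega)
  obtain ⟨C, hC⟩ := exists_lintegral_gaussianWeight_angle hn
  refine ⟨C, ?_, fun e α he hα => ?_⟩
  · obtain ⟨x, hx⟩ := exists_ne (0 : E)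
    simpa using hC (fun _ => 1) measurable_const x hx
  have hS := fun x y : E => gaussianWeight_setOf_mem_pairsInCap hn hα (x := x) (y := y)
  have hKm : Measurable ((Iic α).indicator (fun φ => ENNReal.ofReal ((π - φ) / (2 * π)))) :=
    Measurable.indicator (by fun_prop) measurableSet_Iic
  generalize (Iic α).indicator (fun φ => ENNReal.ofReal ((π - φ) / (2 * π))) = K at hS hKm ⊢
  have hSm := measurableSet_setOf_mem_pairsInCap (E := E) α
  have hcongr := fun {e'} (he' : e' ≠ 0) => gaussianWeight_prod_pairsInCap_congr hn α he' he
  have h0 := ae_ne_zero_gaussianWeight (E := E)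
  have huniv := gaussianWeight_univ_ne_zero (E := E)
  have hfin : gaussianWeight E univ ≠ ∞ := measure_ne_top _ _
  -- Only finiteness of the measure and the facts above are needed from here on; both sides below
  -- evaluate the mass of the triples `(e, x, y)` with `(x, y) ∈ pairsInCap e α`.
  generalize hγ : gaussianWeight E = γ at *
  have : IsFiniteMeasure γ := hγ ▸ inferInstance
  have hfst : γ.prod (γ.prod γ) {q | q.2 ∈ pairsInCap q.1 α} =
      γ univ * (γ.prod γ) (pairsInCap e α) := by
    rw [Measure.prod_apply hSm, mul_comm, ← lintegral_const]
    refine lintegral_congr_ae ?_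
    filter_upwards [h0] with e' he'
    exact hcongr he'
  have hsnd : γ.prod (γ.prod γ) {q | q.2 ∈ pairsInCap q.1 α} =
      γ univ * (γ univ * (C * ∫⁻ φ in Ioo 0 π, ENNReal.ofReal (sin φ ^ n) * K φ)) := by
    rw [Measure.prod_apply_symm hSm, lintegral_prod _
      (measurable_measure_prodMk_right hSm).aemeasurable, mul_comm (γ univ), ← lintegral_const]
    refine lintegral_congr_ae ?_
    filter_upwards [h0] with x hx
    have hKang : Measurable fun y => K (angle x y) := hKm.comp (measurable_angle_right x)
    rw [← hC K hKm x hx, ← lintegral_const_mul _ hKang]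
    refine lintegral_congr_ae ?_
    filter_upwards [h0] with y hy
    exact hS x y hx hy
  exact (ENNReal.mul_right_inj huniv hfin).1 (hfst.symm.trans hsnd)

theorem gaussianWeight_prod_real_pairsInCap (hn : Module.finrank ℝ E = 4) {e : E} (he : e ≠ 0)
    {α : ℝ} (h₀ : 0 ≤ α) (h₁ : α < π) :
    ((gaussianWeight E).prod (gaussianWeight E)).real (pairsInCap e α) =
      (gaussianWeight E).real univ ^ 2 / π ^ 2 * ∫ φ in (0 : ℝ)..α, (π - φ) * sin φ ^ 2 := by
  obtain ⟨C, hC, h⟩ := exists_gaussianWeight_prod_pairsInCap (E := E) (n := 2) hn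
  have hsin : ∫⁻ φ in Ioo 0 π, ENNReal.ofReal (sin φ ^ 2) = ENNReal.ofReal (π / 2) := by
    rw [restrict_Ioo_eq_restrict_Ioc, ← ofReal_integral_eq_lintegral_ofReal,
      ← intervalIntegral.integral_of_le pi_pos.le, integral_sin_sq]
    · simp
    · exact (Continuous.integrableOn_Icc (by fun_prop)).mono_set Ioc_subset_Icc_self
    · exact Filter.Eventually.of_forall fun φ => sq_nonneg _
  have hcap : ∫⁻ φ in Ioo 0 π, ENNReal.ofReal (sin φ ^ 2) *
      (Iic α).indicator (fun φ => ENNReal.ofReal ((π - φ) / (2 * π))) φ =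
      ENNReal.ofReal ((2 * π)⁻¹ * ∫ φ in (0 : ℝ)..α, (π - φ) * sin φ ^ 2) := by
    rw [← intervalIntegral.integral_const_mul, intervalIntegral.integral_of_le h₀,
      ofReal_integral_eq_lintegral_ofReal]
    · have hset : Ioo 0 π ∩ Iic α = Ioc 0 α := by
        ext φ
        simp only [mem_inter_iff, mem_Ioo, mem_Iic, mem_Ioc]
        constructor
        · rintro ⟨⟨a, -⟩, b⟩; exact ⟨a, b⟩
        · rintro ⟨a, b⟩; exact ⟨⟨a, by linarith⟩, b⟩
      simp_rw [← indicator_mul_right (Iic α) (fun φ => ENNReal.ofReal (sin φ ^ 2))]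
      rw [setLIntegral_indicator measurableSet_Iic, inter_comm, hset]
      refine lintegral_congr fun φ => ?_
      rw [← ENNReal.ofReal_mul (sq_nonneg _)]
      congr 1
      field_simp
    · exact (Continuous.integrableOn_Icc (by fun_prop)).mono_set Ioc_subset_Icc_self
    · filter_upwards [ae_restrict_mem measurableSet_Ioc] with φ hφ
      have : 0 ≤ π - φ := by linarith [hφ.2]
      have := pi_pos
      simp only [Pi.zero_apply]
      positivity
  have hJ : 0 ≤ ∫ φ in (0 : ℝ)..α, (π - φ) * sin φ ^ 2 :=
    intervalIntegral.integral_nonneg h₀ fun φ hφ =>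
      mul_nonneg (by linarith [hφ.2]) (sq_nonneg _)
  rw [hsin] at hC
  have hC' := congrArg ENNReal.toReal hC
  rw [ENNReal.toReal_mul, ENNReal.toReal_ofReal (by positivity)] at hC'
  rw [measureReal_def, measureReal_def, h e α he h₁, hcap, ENNReal.toReal_mul, ENNReal.toReal_mul,
    ENNReal.toReal_ofReal (by positivity), hC']
  field_simp

end angles

/-! ### From the hemisphere to the Gaussian weight -/

theorem cond_smul_measure {Ω : Type*} [MeasurableSpace Ω] (ν : Measure Ω) (H : Set Ω) {κ : ℝ≥0∞}
    (h₀ : κ ≠ 0) (h₁ : κ ≠ ∞) :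
    ProbabilityTheory.cond (κ • ν) H = ProbabilityTheory.cond ν H := by
  rw [ProbabilityTheory.cond, ProbabilityTheory.cond, Measure.restrict_smul, smul_smul,
    Measure.smul_apply, smul_eq_mul, ENNReal.mul_inv (.inl h₀) (.inl h₁), mul_right_comm,
    ENNReal.inv_mul_cancel h₀ h₁, one_mul]

theorem cond_prod_cond_real {Ω : Type*} [MeasurableSpace Ω] (ν : Measure Ω) [IsFiniteMeasure ν]
    {H : Set Ω} (hH : MeasurableSet H) (D : Set (Ω × Ω)) :
    ((ProbabilityTheory.cond ν H).prod (ProbabilityTheory.cond ν H)).real D =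
      (ν.prod ν).real (D ∩ H ×ˢ H) / ν.real H ^ 2 := by
  rw [ProbabilityTheory.cond, Measure.prod_smul_left, Measure.prod_smul_right,
    Measure.prod_restrict, smul_smul, measureReal_ennreal_smul_apply, measureReal_restrict_apply']
  · simp only [measureReal_def, ENNReal.toReal_mul, ENNReal.toReal_inv]
    ring
  · exact hH.prod hH

theorem hyperHemisphere_four (R : ℝ) :
    hyperHemisphere 4 R = sphere (0 : EuclideanSpace ℝ (Fin 4)) R ∩ {p | 0 ≤ p 3} := by
  ext p
  simp only [hyperHemisphere, mem_inter_iff, mem_ofPred_eq]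
  refine and_congr_right fun _ => ⟨fun h => h 3 rfl, fun h i hi => ?_⟩
  have : i = 3 := Fin.ext (by simp; omega)
  rwa [this]

/-- Surface measure on the sphere of radius `R` is a multiple of the image of the Gaussian weight
under radial projection. -/
theorem sphereSurface_eq_smul_map_gaussianWeight {N : ℕ} (hN : N ≠ 0) {R : ℝ} (hR : 0 < R) :
    ∃ κ : ℝ≥0∞, κ ≠ 0 ∧ κ ≠ ∞ ∧ sphereSurface N R =
      κ • (gaussianWeight (EuclideanSpace ℝ (Fin N))).map fun x => R • ‖x‖⁻¹ • x := by
  have : Nonempty (Fin N) := ⟨⟨0, Nat.pos_of_ne_zero hN⟩⟩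
  obtain ⟨c, hc₀, hc₁, hc⟩ := map_normalize_gaussianWeight (E := EuclideanSpace ℝ (Fin N))
  have hR' : 0 < R ^ (N - 1) := pow_pos hR _
  refine ⟨ENNReal.ofReal (R ^ (N - 1)) * c⁻¹, mul_ne_zero (by simpa using hR')
    (ENNReal.inv_ne_zero.2 hc₁), ENNReal.mul_ne_top ENNReal.ofReal_ne_top
    (ENNReal.inv_ne_top.2 hc₀), ?_⟩
  have hcomp : (fun x : EuclideanSpace ℝ (Fin N) => R • ‖x‖⁻¹ • x) =
      (fun x => R • x) ∘ fun x => ‖x‖⁻¹ • x := rfl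
  rw [hcomp, ← Measure.map_map (by fun_prop) (by fun_prop), hc, Measure.map_smul, smul_smul,
    mul_assoc, ENNReal.inv_mul_cancel hc₀ hc₁, mul_one,
    Measure.map_map (by fun_prop) measurable_subtype_coe]
  rfl

theorem dist_smul_normalize_le_iff {E : Type*} [NormedAddCommGroup E] [InnerProductSpace ℝ E]
    {R d : ℝ} (hR : 0 < R) (hd : 0 ≤ d) {x y : E} (hx : x ≠ 0) (hy : y ≠ 0) :
    dist (R • ‖x‖⁻¹ • x) (R • ‖y‖⁻¹ • y) ≤ d ↔ 1 - d ^ 2 / (2 * R ^ 2) ≤ cos (angle x y) := by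
  have hx' : ‖x‖ ≠ 0 := norm_ne_zero_iff.2 hx
  have hy' : ‖y‖ ≠ 0 := norm_ne_zero_iff.2 hy
  have h : dist (R • ‖x‖⁻¹ • x) (R • ‖y‖⁻¹ • y) ^ 2 = R ^ 2 * (2 - 2 * cos (angle x y)) := by
    rw [dist_smul₀, mul_pow, dist_eq_norm, norm_sub_sq_real, norm_smul, norm_smul,
      real_inner_smul_left, real_inner_smul_right, cos_angle]
    simp only [Real.norm_of_nonneg hR.le, norm_inv, norm_norm, inv_mul_cancel₀ hx',
      inv_mul_cancel₀ hy']
    field_simp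
    ring
  rw [← pow_le_pow_iff_left₀ dist_nonneg hd two_ne_zero, h, sub_le_comm,
    le_div_iff₀ (by positivity)]
  constructor <;> intro h <;> linarith

/-- The chord length cdf on the hemisphere of `ℝ⁴`, in terms of the central angle `α` of a chord of
length `d`. -/
theorem hemisphereChordCDF_four {R d α : ℝ} (hR : 0 < R) (hd : 0 ≤ d) (h₀ : 0 ≤ α) (h₁ : α < π)
    (hα : cos α = 1 - d ^ 2 / (2 * R ^ 2)) :
    hemisphereChordCDF 4 R d = 4 / π ^ 2 * ∫ φ in (0 : ℝ)..α, (π - φ) * sin φ ^ 2 := by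
  set γ := gaussianWeight (EuclideanSpace ℝ (Fin 4)) with hγ
  set e : EuclideanSpace ℝ (Fin 4) := EuclideanSpace.single 3 1 with he
  have he0 : e ≠ 0 := by simp [he]
  have hfin : Module.finrank ℝ (EuclideanSpace ℝ (Fin 4)) = 2 + 2 := by simp
  set P : EuclideanSpace ℝ (Fin 4) → EuclideanSpace ℝ (Fin 4) := fun x => R • ‖x‖⁻¹ • x with hP
  have hPm : Measurable P := by fun_prop
  obtain ⟨κ, hκ₀, hκ₁, hκ⟩ := sphereSurface_eq_smul_map_gaussianWeight (N := 4) (by simp) hR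
  have hHm : MeasurableSet (hyperHemisphere 4 R) := by
    rw [hyperHemisphere_four]
    exact isClosed_sphere.measurableSet.inter (measurableSet_le (by fun_prop) (by fun_prop))
  have hmem : ∀ x, x ≠ 0 → (P x ∈ hyperHemisphere 4 R ↔ 0 ≤ ⟪e, x⟫) := fun x hx => by
    have hx' : ‖x‖ ≠ 0 := norm_ne_zero_iff.2 hx
    have hx'' : 0 < ‖x‖ := norm_pos_iff.2 hx
    rw [hyperHemisphere_four]
    simp [hP, he, norm_smul, hx', abs_of_pos hR, EuclideanSpace.inner_single_left,
      mul_nonneg_iff_of_pos_left, hR, hx'']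
  have h0 : ∀ᵐ x ∂γ, x ≠ 0 := ae_ne_zero_gaussianWeight
  have hden : (γ.map P).real (hyperHemisphere 4 R) = γ.real univ / 2 := by
    have hae : P ⁻¹' hyperHemisphere 4 R =ᵐ[γ] {x | 0 ≤ ⟪x, e⟫} := by
      filter_upwards [h0] with x hx
      exact propext ((hmem x hx).trans (by rw [real_inner_comm]; rfl))
    rw [map_measureReal_apply hPm hHm, measureReal_congr hae, measureReal_def,
      gaussianWeight_halfSpace hfin he0, ENNReal.toReal_mul, ENNReal.toReal_ofReal (by norm_num),
      measureReal_def]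
    ring
  have hnum : ((γ.map P).prod (γ.map P)).real ({x | dist x.1 x.2 ≤ d} ∩
      hyperHemisphere 4 R ×ˢ hyperHemisphere 4 R) = (γ.prod γ).real (pairsInCap e α) := by
    have hae : Prod.map P P ⁻¹' ({x | dist x.1 x.2 ≤ d} ∩
        hyperHemisphere 4 R ×ˢ hyperHemisphere 4 R) =ᵐ[γ.prod γ] pairsInCap e α := by
      filter_upwards [Measure.quasiMeasurePreserving_fst.ae h0,
        Measure.quasiMeasurePreserving_snd.ae h0] with p hp hq
      have hle : dist (P p.1) (P p.2) ≤ d ↔ angle p.1 p.2 ≤ α := by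
        rw [dist_smul_normalize_le_iff hR hd hp hq, ← hα,
          strictAntiOn_cos.le_iff_ge ⟨h₀, h₁.le⟩ ⟨angle_nonneg _ _, angle_le_pi _ _⟩]
      refine propext ?_
      change (dist (P p.1) (P p.2) ≤ d ∧ P p.1 ∈ hyperHemisphere 4 R ∧
        P p.2 ∈ hyperHemisphere 4 R) ↔ (0 ≤ ⟪e, p.1⟫ ∧ 0 ≤ ⟪e, p.2⟫ ∧ angle p.1 p.2 ≤ α)
      rw [hle, hmem _ hp, hmem _ hq]
      tauto
    rw [Measure.map_prod_map _ _ hPm hPm, map_measureReal_apply (hPm.prodMap hPm),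
      measureReal_congr hae]
    exact (measurableSet_le (by fun_prop) (by fun_prop)).inter (hHm.prod hHm)
  have hg : γ.real univ ≠ 0 := by
    rw [measureReal_def]
    exact ENNReal.toReal_ne_zero.2 ⟨gaussianWeight_univ_ne_zero, measure_ne_top _ _⟩
  rw [hemisphereChordCDF, hemisphereUniform, hκ, cond_smul_measure _ _ hκ₀ hκ₁,
    cond_prod_cond_real _ hHm, hden, hnum,
    gaussianWeight_prod_real_pairsInCap hfin he0 h₀ h₁]
  field_simp
  ring

/-! ### Trigonometric integrals and incomplete beta functions -/

theorem hasDerivAt_sin_mul_cos (φ : ℝ) :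
    HasDerivAt (fun φ => sin φ * cos φ) (cos φ ^ 2 - sin φ ^ 2) φ := by
  refine HasDerivAt.congr_deriv ((hasDerivAt_sin φ).mul (hasDerivAt_cos φ)) ?_
  ring

theorem integral_pi_sub_mul_sin_sq (α : ℝ) : ∫ φ in (0 : ℝ)..α, (π - φ) * sin φ ^ 2 =
    π / 2 * (α - sin α * cos α) - (α ^ 2 - 2 * α * (sin α * cos α) + sin α ^ 2) / 4 := by
  rw [intervalIntegral.integral_eq_sub_of_hasDerivAt (f := fun φ => π / 2 * (φ - sin φ * cos φ) -
    (φ ^ 2 - 2 * (φ * (sin φ * cos φ)) + sin φ ^ 2) / 4)]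
  · simp; ring
  · intro φ _
    have h := hasDerivAt_sin_mul_cos φ
    refine HasDerivAt.congr_deriv ((((hasDerivAt_id φ).sub h).const_mul
      (π / 2)).sub (((((hasDerivAt_id φ).pow 2).sub
      (((hasDerivAt_id φ).mul h).const_mul 2)).add ((hasDerivAt_sin φ).pow 2)).div_const 4)) ?_
    simp only [id, cos_sq' φ]
    ring
  · exact Continuous.intervalIntegrable (by fun_prop) _ _

theorem integral_mul_cos_sq (α : ℝ) : ∫ φ in (0 : ℝ)..α, φ * cos φ ^ 2 =
    (α ^ 2 + 2 * α * (sin α * cos α) - sin α ^ 2) / 4 := by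
  rw [intervalIntegral.integral_eq_sub_of_hasDerivAt (f := fun φ =>
    (φ ^ 2 + 2 * (φ * (sin φ * cos φ)) - sin φ ^ 2) / 4)]
  · simp; ring
  · intro φ _
    have h := hasDerivAt_sin_mul_cos φ
    refine HasDerivAt.congr_deriv (((((hasDerivAt_id φ).pow 2).add
      (((hasDerivAt_id φ).mul h).const_mul 2)).sub ((hasDerivAt_sin φ).pow 2)).div_const 4) ?_
    simp only [id, cos_sq' φ]
    ring
  · exact Continuous.intervalIntegrable (by fun_prop) _ _

/-- The fundamental theorem of calculus for the incomplete beta function. The integrand may be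
unbounded at `0` and `1`; as it is nonnegative, its integrability comes from the primitive. -/
theorem incBeta_eq_of_hasDerivAt {x a b : ℝ} {F : ℝ → ℝ} (h₀ : 0 ≤ x) (h₁ : x ≤ 1)
    (hF : ContinuousOn F (Icc 0 1))
    (hF' : ∀ t ∈ Ioo (0 : ℝ) 1, HasDerivAt F (t ^ (a - 1) * (1 - t) ^ (b - 1)) t) :
    incBeta x a b = F x - F 0 := by
  have hx : Ioo 0 x ⊆ Ioo 0 1 := Ioo_subset_Ioo_right h₁
  have hc := hF.mono (Icc_subset_Icc_right h₁)
  refine intervalIntegral.integral_eq_sub_of_hasDerivAt_of_le h₀ hc (fun t ht => hF' t (hx ht)) ?_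
  rw [intervalIntegrable_iff_integrableOn_Ioc_of_le h₀]
  exact intervalIntegral.integrableOn_deriv_of_nonneg hc (fun t ht => hF' t (hx ht))
    fun t ht => mul_nonneg (rpow_nonneg ht.1.le _)
      (rpow_nonneg (by linarith [(hx ht).2]) _)

theorem hasDerivAt_arcsin_sqrt {t : ℝ} (ht : t ∈ Ioo (0 : ℝ) 1) :
    HasDerivAt (fun t => arcsin √t) (1 / (2 * √t * √(1 - t))) t := by
  have h₀ : 0 < √t := sqrt_pos.2 ht.1
  have h₁ : √t < 1 := by rw [sqrt_lt' one_pos]; simpa using ht.2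
  refine HasDerivAt.congr_deriv ((hasDerivAt_arcsin (by linarith) h₁.ne).comp t
    (hasDerivAt_sqrt ht.1.ne')) ?_
  rw [sq_sqrt ht.1.le]
  ring

theorem hasDerivAt_sqrt_mul_sqrt_one_sub {t : ℝ} (ht : t ∈ Ioo (0 : ℝ) 1) :
    HasDerivAt (fun t => √t * √(1 - t)) ((1 - 2 * t) / (2 * √t * √(1 - t))) t := by
  have h₀ : 0 < √t := sqrt_pos.2 ht.1
  have h₁ : 0 < √(1 - t) := sqrt_pos.2 (sub_pos.2 ht.2)
  refine HasDerivAt.congr_deriv ((hasDerivAt_sqrt ht.1.ne').mul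
    (((hasDerivAt_id t).const_sub 1).sqrt (sub_pos.2 ht.2).ne')) ?_
  simp only [id]
  field_simp
  rw [sq_sqrt ht.1.le, sq_sqrt (sub_pos.2 ht.2).le]
  ring

theorem incBeta_three_halves_one_half {x : ℝ} (h₀ : 0 ≤ x) (h₁ : x ≤ 1) :
    incBeta x (3 / 2) (1 / 2) = arcsin √x - √x * √(1 - x) := by
  rw [incBeta_eq_of_hasDerivAt (F := fun t => arcsin √t - √t * √(1 - t)) h₀ h₁ (by fun_prop)]
  · simp
  · intro t ht
    refine HasDerivAt.congr_deriv ((hasDerivAt_arcsin_sqrt ht).sub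
      (hasDerivAt_sqrt_mul_sqrt_one_sub ht)) ?_
    have h2 : 0 < √t := sqrt_pos.2 ht.1
    have h3 : 0 < √(1 - t) := sqrt_pos.2 (sub_pos.2 ht.2)
    rw [show (3 / 2 - 1 : ℝ) = 1 / 2 by norm_num, show (1 / 2 - 1 : ℝ) = -(1 / 2) by norm_num,
      rpow_neg (sub_pos.2 ht.2).le, ← sqrt_eq_rpow, ← sqrt_eq_rpow]
    field_simp
    rw [sq_sqrt ht.1.le]
    ring

theorem incBeta_one_half_three_halves {x : ℝ} (h₀ : 0 ≤ x) (h₁ : x ≤ 1) :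
    incBeta x (1 / 2) (3 / 2) = arcsin √x + √x * √(1 - x) := by
  rw [incBeta_eq_of_hasDerivAt (F := fun t => arcsin √t + √t * √(1 - t)) h₀ h₁ (by fun_prop)]
  · simp
  · intro t ht
    refine HasDerivAt.congr_deriv ((hasDerivAt_arcsin_sqrt ht).add
      (hasDerivAt_sqrt_mul_sqrt_one_sub ht)) ?_
    have h2 : 0 < √t := sqrt_pos.2 ht.1
    have h3 : 0 < √(1 - t) := sqrt_pos.2 (sub_pos.2 ht.2)
    rw [show (3 / 2 - 1 : ℝ) = 1 / 2 by norm_num, show (1 / 2 - 1 : ℝ) = -(1 / 2) by norm_num,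
      rpow_neg ht.1.le, ← sqrt_eq_rpow, ← sqrt_eq_rpow]
    field_simp
    rw [sq_sqrt (sub_pos.2 ht.2).le]
    ring

theorem completeBeta_three_halves_one_half : completeBeta (3 / 2) (1 / 2) = π / 2 := by
  rw [completeBeta, incBeta_three_halves_one_half zero_le_one le_rfl]
  simp

theorem completeBeta_one_half_three_halves : completeBeta (1 / 2) (3 / 2) = π / 2 := by
  rw [completeBeta, incBeta_one_half_three_halves zero_le_one le_rfl]
  simp

/-- The closed form of the right-hand side, with `1 - d² / 2R² = cos α` and `s = sin² α`. -/
theorem chordP1_sub_chordP2_add_chordP3_four {R d α : ℝ} (h₀ : 0 ≤ α)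
    (h₁ : α ≤ π / 2) (hα : cos α = 1 - d ^ 2 / (2 * R ^ 2)) :
    chordP1 4 R d - chordP2 4 R d + chordP3 4 R d = 2 / π * (α - sin α * cos α) -
      (α ^ 2 - 2 * α * (sin α * cos α) + sin α ^ 2) / π ^ 2 := by
  have hπ := pi_pos
  have hs : 0 ≤ sin α := sin_nonneg_of_nonneg_of_le_pi h₀ (by linarith)
  have hc : 0 ≤ cos α := cos_nonneg_of_neg_pi_div_two_le_of_le (by linarith) h₁
  have harg : chordArg R d = sin α ^ 2 := by
    rw [sin_sq, hα, chordArg]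
    ring
  have hsqrt : √(sin α ^ 2) = sin α := sqrt_sq hs
  have hsqrt' : √(1 - sin α ^ 2) = cos α := by rw [← cos_sq', sqrt_sq hc]
  have harcsin : arcsin (sin α) = α := arcsin_sin (by linarith) h₁
  have hI : regBeta (sin α ^ 2) (3 / 2) (1 / 2) = 2 / π * (α - sin α * cos α) := by
    rw [regBeta, incBeta_three_halves_one_half (sq_nonneg _) (sin_sq_le_one α), hsqrt, hsqrt',
      harcsin, completeBeta_three_halves_one_half]
    field_simp
  have hI' : regBeta (sin α ^ 2) (1 / 2) (3 / 2) = 2 / π * (α + sin α * cos α) := by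
    rw [regBeta, incBeta_one_half_three_halves (sq_nonneg _) (sin_sq_le_one α), hsqrt, hsqrt',
      harcsin, completeBeta_one_half_three_halves]
    field_simp
  have h32 : (((4 : ℕ) : ℝ) - 1) / 2 = 3 / 2 := by norm_num
  rw [chordP1, chordP2, chordP3, h32, harg, hI, hI', hsqrt, harcsin,
    completeBeta_three_halves_one_half, ← hα, integral_mul_cos_sq]
  -- At `α = 0` both quotients are `0 / 0 = 0`; otherwise the incomplete beta function
  -- `I_s(3/2, 1/2)` is nonzero and cancels.
  rcases h₀.eq_or_lt with rfl | hpos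
  · simp
  · have hne : α - sin α * cos α ≠ 0 := by
      have := sin_lt hpos
      have := mul_le_of_le_one_right hs (cos_le_one α)
      linarith
    have h4 : cos α ^ 4 = cos α ^ 2 * (1 - sin α ^ 2) := by rw [← cos_sq']; ring
    rw [h4]
    push_cast
    field_simp
    ring

theorem proposition6 (R d : ℝ) (hR : 0 < R) (hd₀ : 0 ≤ d) (hd : d ≤ Real.sqrt 2 * R) :
    hemisphereChordCDF 4 R d = chordP1 4 R d - chordP2 4 R d + chordP3 4 R d := by
  have hd2 : d ^ 2 ≤ 2 * R ^ 2 := by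
    calc d ^ 2 ≤ (√2 * R) ^ 2 := by gcongr
      _ = 2 * R ^ 2 := by rw [mul_pow, sq_sqrt zero_le_two]
  have hc₀ : 0 ≤ 1 - d ^ 2 / (2 * R ^ 2) := sub_nonneg.2 (div_le_one_of_le₀ hd2 (by positivity))
  have hc₁ : 1 - d ^ 2 / (2 * R ^ 2) ≤ 1 := sub_le_self _ (by positivity)
  set α := arccos (1 - d ^ 2 / (2 * R ^ 2)) with hαdef
  have hα : cos α = 1 - d ^ 2 / (2 * R ^ 2) := cos_arccos (by linarith) hc₁
  have h₀ : 0 ≤ α := arccos_nonneg _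
  have h₁ : α ≤ π / 2 := arccos_le_pi_div_two.2 hc₀
  rw [hemisphereChordCDF_four hR hd₀ h₀ (by linarith [pi_pos]) hα, integral_pi_sub_mul_sin_sq,
    chordP1_sub_chordP2_add_chordP3_four h₀ h₁ hα]
  have := pi_ne_zero
  field_simp
  ring
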